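/- **Well-posedness of the random mixed problem.** Let $d\in\{2,3\}$, let $D\subset\mathbb R^d$ be a bounded Lipschitz polygonal/polyhedral domain and let $(\Omega,\mathcal A,P)$ be a probability space. Let $a(\omega,x)$, $\omega\in\Omega$, $x\in\overline D$, be a real random field. For $0<t\le1$ let $C^t(\overline D)$ be the space of Hölder continuous functions with exponent $t$ (Lipschitz functions if $t=1$), $H^t(D)$ the Sobolev (Slobodeckij) space, and $H^{1/2+t}(\partial D)$ the space of traces on $\partial D$ of functions in $H^{1+t}(D)$. For a Banach space $B$, $L^p(\Omega,B)$ is the space of $B$-valued random variables with finite $p$-th moment of the norm. Put $a_{\min}(\omega)=\min_{x\in\overline D}a(\omega,x)$ and assume: * **A1.** $a_{\min}>0$ $P$-a.s. and $1/a_{\min}\in L^p(\Omega)$ for all $p\in[1,\infty)$; * **A2.** $a\in L^p(\Omega,C^s(\overline D))$ for some $0<s\le1$ and all $p\in[1,\infty)$ (it suffices that each $a(\cdot,x)$ is measurable and that the random variable $\|a_\omega\|_{C^s(\overline D)}$ is in $L^p(\Omega)$ for all $p\in[1,\infty)$); * **A3.** $u_\Gamma\in H^{1/2+t}(\partial D)$,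 $g\in L^r(\Omega,H^t(D)^d)$ and $f\in L^r(\Omega,H^t(D))$ for some $0<t\le1$ and some $r\in[1,\infty)$. Let $H(\mathrm{div},D)=\{v\in L^2(D)^d:\operatorname{div}v\in L^2(D)\}$ with $\|v\|_{H(\mathrm{div})}^2=\|v\|_{L^2}^2+\|\operatorname{div}v\|_{L^2}^2$. For $\omega\in\Omega$ consider the problem of finding $(q_\omega,u_\omega)\in H(\mathrm{div},D)\times L^2(D)$ such that $$\int_D a_\omega^{-1}q_\omega\cdot v\,dx-\int_D u_\omega\operatorname{div}v\,dx=\int_D g_\omega\cdot v\,dx-\int_{\partial D}u_\Gamma\,v\cdot\nu\,ds\quad\text{for all }v\in H(\mathrm{div},D),$$ $$-\int_D w\operatorname{div}q_\omega\,dx=-\int_D f_\omega\,w\,dx\quad\text{for all }w\in L^2(D).$$ Here the boundary term is the duality pairing of $u_\Gamma$ with the normal trace of $v$, i.e. $\int_{\partial D}u_\Gamma\,v\cdot\nu\,ds=\int_D(v\cdot\nabla\Phi+\Phi\operatorname{div}v)\,dx$ for any $\Phi\in H^1(D)$ with trace $u_\Gamma$. Then there are random variables $q:\Omega\to H(\mathrm{div},D)$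 and $u:\Omega\to L^2(D)$ such that, for $P$-almost every $\omega$, $(q_\omega,u_\omega)$ solves this problem and is its only solution in $H(\mathrm{div},D)\times L^2(D)$; moreover $q\in L^p(\Omega,H(\mathrm{div},D))$ and $u\in L^p(\Omega,L^2(D))$ for all $1\le p<r$. -/

import Mathlib

open MeasureTheory Filter Topology
open scoped ENNReal NNReal

noncomputable section

namespace MixedDarcy

/-! ### Lebesgue spaces on a domain -/

/-- `ℝ^d` with the Euclidean norm. -/
abbrev E (d : ℕ) : Type := EuclideanSpace ℝ (Fin d)

/-- Lebesgue measure on `D`. -/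
abbrev vol {d : ℕ} (D : Set (E d)) : Measure (E d) := volume.restrict D

/-- `L²(D)`. -/
abbrev L2 {d : ℕ} (D : Set (E d)) : Type := Lp ℝ 2 (vol D)

/-- `L²(D)^d`. -/
abbrev L2Vec {d : ℕ} (D : Set (E d)) : Type := Lp (E d) 2 (vol D)

/-- `L²(D × D)`. -/
abbrev L2Prod {d : ℕ} (D : Set (E d)) : Type := Lp ℝ 2 ((vol D).prod (vol D))

/-! ### Domains -/

/-- Near each boundary point, `D` is the set of points strictly below the graph of a Lipschitz
function `γ` over the hyperplane orthogonal to some unit vector `n` (`γ` is a function of the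
component orthogonal to `n` only). -/
def HasLipschitzBoundary {d : ℕ} (D : Set (E d)) : Prop :=
  ∀ x₀ ∈ frontier D, ∃ (n : E d) (γ : E d → ℝ) (K : ℝ≥0) (ρ : ℝ),
    ‖n‖ = 1 ∧ LipschitzWith K γ ∧ (∀ (x : E d) (c : ℝ), γ (x + c • n) = γ x) ∧ 0 < ρ ∧
      ∀ x ∈ Metric.ball x₀ ρ, x ∈ D ↔ inner ℝ n x < γ x

/-- The boundary of `D` is contained in finitely many hyperplanes `{x | ⟨n, x⟩ = c}`, `n ≠ 0`. -/
def HasFlatFaces {d : ℕ} (D : Set (E d)) : Prop :=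
  ∃ S : Finset (E d × ℝ), (∀ h ∈ S, h.1 ≠ 0) ∧
    ∀ x ∈ frontier D, ∃ h ∈ S, inner ℝ h.1 x = h.2

/-- Bounded Lipschitz polygonal (`d = 2`) or polyhedral (`d = 3`) domains. -/
structure IsLipschitzPolyhedralDomain {d : ℕ} (D : Set (E d)) : Prop where
  isOpen : IsOpen D
  isConnected : IsConnected D
  isBounded : Bornology.IsBounded D
  lipschitz : HasLipschitzBoundary D
  flat : HasFlatFaces D

/-! ### Weak derivatives -/

/-- Test functions: `φ ∈ C_c^∞(D)`. -/
structure IsTestFunction {d : ℕ} (D : Set (E d)) (φ : E d → ℝ) : Prop where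
  smooth : ContDiff ℝ (⊤ : ℕ∞) φ
  compact : HasCompactSupport φ
  support : tsupport φ ⊆ D

/-- `ρ` is the weak divergence of `v` in `D`:
`∫_D v · ∇φ = - ∫_D ρ φ` for all `φ ∈ C_c^∞(D)`. -/
def IsWeakDiv {d : ℕ} (D : Set (E d)) (v : L2Vec D) (ρ : L2 D) : Prop :=
  ∀ φ : E d → ℝ, IsTestFunction D φ →
    ∫ x in D, fderiv ℝ φ x (v x) = -∫ x in D, ρ x * φ x

/-- `G` is the weak gradient of `f` in `D`:
`∫_D f ∂ᵢφ = - ∫_D Gᵢ φ` for all `φ ∈ C_c^∞(D)` and all `i`. -/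
def IsWeakGrad {d : ℕ} (D : Set (E d)) (f : L2 D) (G : L2Vec D) : Prop :=
  ∀ φ : E d → ℝ, IsTestFunction D φ → ∀ i : Fin d,
    ∫ x in D, f x * fderiv ℝ φ x (EuclideanSpace.single i 1) = -∫ x in D, G x i * φ x

/-- `F(x, y) = (f(x) - f(y)) / |x - y|^{d/2 + t}` for almost all `(x, y) ∈ D × D`; the square of
the `L²(D × D)`-norm of `F` is the Gagliardo (Slobodeckij) double integral
`∫∫ |f(x) - f(y)|² / |x - y|^{d + 2t}`. -/
def IsDiffQuot {d : ℕ} (D : Set (E d)) (t : ℝ) (f : L2 D) (F : L2Prod D) : Prop :=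
  ∀ᵐ z ∂((vol D).prod (vol D)), F z = (f z.1 - f z.2) / ‖z.1 - z.2‖ ^ ((d : ℝ) / 2 + t)

section helpers

variable {d : ℕ} {D : Set (E d)}

theorem IsTestFunction.memLp {φ : E d → ℝ} (hφ : IsTestFunction D φ) :
    MemLp φ 2 (vol D) :=
  (hφ.smooth.continuous.memLp_of_hasCompactSupport hφ.compact).restrict D

theorem IsTestFunction.memLp_fderiv {φ : E d → ℝ} (hφ : IsTestFunction D φ) :
    MemLp (fderiv ℝ φ) 2 (vol D) :=
  ((hφ.smooth.continuous_fderiv (by simp)).memLp_of_hasCompactSupport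
    (hφ.compact.fderiv ℝ)).restrict D

theorem IsTestFunction.integrable_mul {φ : E d → ℝ} (hφ : IsTestFunction D φ) (ρ : L2 D) :
    Integrable (fun x => ρ x * φ x) (vol D) :=
  (Lp.memLp ρ).integrable_mul hφ.memLp

theorem IsTestFunction.integrable_fderiv {φ : E d → ℝ} (hφ : IsTestFunction D φ)
    (v : L2Vec D) : Integrable (fun x => fderiv ℝ φ x (v x)) (vol D) := by
  refine ((hφ.memLp_fderiv.norm.integrable_mul (Lp.memLp v).norm)).mono' ?_ ?_
  · exact (ContinuousLinearMap.id ℝ (E d →L[ℝ] ℝ)).aestronglyMeasurable_comp₂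
      hφ.memLp_fderiv.1 (Lp.memLp v).1
  · exact Eventually.of_forall fun x => (fderiv ℝ φ x).le_opNorm (v x)

theorem IsTestFunction.integrable_mul_partial {φ : E d → ℝ} (hφ : IsTestFunction D φ)
    (f : L2 D) (i : Fin d) :
    Integrable (fun x => f x * fderiv ℝ φ x (EuclideanSpace.single i 1)) (vol D) :=
  (Lp.memLp f).integrable_mul
    ((ContinuousLinearMap.apply ℝ ℝ (EuclideanSpace.single i (1 : ℝ))).comp_memLp'
      hφ.memLp_fderiv)

theorem IsTestFunction.integrable_coord_mul {φ : E d → ℝ} (hφ : IsTestFunction D φ)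
    (G : L2Vec D) (i : Fin d) : Integrable (fun x => G x i * φ x) (vol D) :=
  ((EuclideanSpace.proj (𝕜 := ℝ) i).comp_memLp' (Lp.memLp G)).integrable_mul hφ.memLp

theorem isWeakDiv_zero : IsWeakDiv D 0 0 := by
  intro φ _
  have h1 : ∫ x in D, fderiv ℝ φ x ((0 : L2Vec D) x) = 0 := by
    rw [integral_congr_ae (g := fun _ => (0 : ℝ))]
    · simp
    · filter_upwards [Lp.coeFn_zero (E d) 2 (vol D)] with x hx
      rw [hx]; simp
  have h2 : ∫ x in D, (0 : L2 D) x * φ x = 0 := by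
    rw [integral_congr_ae (g := fun _ => (0 : ℝ))]
    · simp
    · filter_upwards [Lp.coeFn_zero ℝ 2 (vol D)] with x hx
      rw [hx]; simp
  rw [h1, h2, neg_zero]

theorem IsWeakDiv.add {v w : L2Vec D} {ρ τ : L2 D} (hv : IsWeakDiv D v ρ)
    (hw : IsWeakDiv D w τ) : IsWeakDiv D (v + w) (ρ + τ) := by
  intro φ hφ
  have h1 : ∫ x in D, fderiv ℝ φ x ((v + w) x)
      = ∫ x in D, (fderiv ℝ φ x (v x) + fderiv ℝ φ x (w x)) := by
    refine integral_congr_ae ?_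
    filter_upwards [Lp.coeFn_add v w] with x hx
    rw [hx]; simp
  have h2 : ∫ x in D, (ρ + τ) x * φ x = ∫ x in D, (ρ x * φ x + τ x * φ x) := by
    refine integral_congr_ae ?_
    filter_upwards [Lp.coeFn_add ρ τ] with x hx
    rw [hx]; simp [add_mul]
  rw [h1, h2, integral_add (hφ.integrable_fderiv v) (hφ.integrable_fderiv w),
    integral_add (hφ.integrable_mul ρ) (hφ.integrable_mul τ), hv φ hφ, hw φ hφ]
  ring

theorem IsWeakDiv.smul (c : ℝ) {v : L2Vec D} {ρ : L2 D} (hv : IsWeakDiv D v ρ) :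
    IsWeakDiv D (c • v) (c • ρ) := by
  intro φ hφ
  have h1 : ∫ x in D, fderiv ℝ φ x ((c • v) x) = ∫ x in D, c * fderiv ℝ φ x (v x) := by
    refine integral_congr_ae ?_
    filter_upwards [Lp.coeFn_smul c v] with x hx
    rw [hx]; simp
  have h2 : ∫ x in D, (c • ρ) x * φ x = ∫ x in D, c * (ρ x * φ x) := by
    refine integral_congr_ae ?_
    filter_upwards [Lp.coeFn_smul c ρ] with x hx
    rw [hx]; simp [mul_assoc]
  rw [h1, h2, integral_const_mul, integral_const_mul, hv φ hφ]
  ring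

theorem isWeakGrad_zero : IsWeakGrad D 0 0 := by
  intro φ _ i
  have h1 : ∫ x in D, (0 : L2 D) x * fderiv ℝ φ x (EuclideanSpace.single i 1) = 0 := by
    rw [integral_congr_ae (g := fun _ => (0 : ℝ))]
    · simp
    · filter_upwards [Lp.coeFn_zero ℝ 2 (vol D)] with x hx
      rw [hx]; simp
  have h2 : ∫ x in D, (0 : L2Vec D) x i * φ x = 0 := by
    rw [integral_congr_ae (g := fun _ => (0 : ℝ))]
    · simp
    · filter_upwards [Lp.coeFn_zero (E d) 2 (vol D)] with x hx
      rw [hx]; simp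
  rw [h1, h2, neg_zero]

theorem IsWeakGrad.add {f g : L2 D} {F G : L2Vec D} (hf : IsWeakGrad D f F)
    (hg : IsWeakGrad D g G) : IsWeakGrad D (f + g) (F + G) := by
  intro φ hφ i
  have h1 : ∫ x in D, (f + g) x * fderiv ℝ φ x (EuclideanSpace.single i 1)
      = ∫ x in D, (f x * fderiv ℝ φ x (EuclideanSpace.single i 1)
          + g x * fderiv ℝ φ x (EuclideanSpace.single i 1)) := by
    refine integral_congr_ae ?_
    filter_upwards [Lp.coeFn_add f g] with x hx
    rw [hx]; simp [add_mul]
  have h2 : ∫ x in D, (F + G) x i * φ x = ∫ x in D, (F x i * φ x + G x i * φ x) := by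
    refine integral_congr_ae ?_
    filter_upwards [Lp.coeFn_add F G] with x hx
    rw [hx]; simp [add_mul]
  rw [h1, h2, integral_add (hφ.integrable_mul_partial f i) (hφ.integrable_mul_partial g i),
    integral_add (hφ.integrable_coord_mul F i) (hφ.integrable_coord_mul G i),
    hf φ hφ i, hg φ hφ i]
  ring

theorem IsWeakGrad.smul (c : ℝ) {f : L2 D} {F : L2Vec D} (hf : IsWeakGrad D f F) :
    IsWeakGrad D (c • f) (c • F) := by
  intro φ hφ i
  have h1 : ∫ x in D, (c • f) x * fderiv ℝ φ x (EuclideanSpace.single i 1)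
      = ∫ x in D, c * (f x * fderiv ℝ φ x (EuclideanSpace.single i 1)) := by
    refine integral_congr_ae ?_
    filter_upwards [Lp.coeFn_smul c f] with x hx
    rw [hx]; simp [mul_assoc]
  have h2 : ∫ x in D, (c • F) x i * φ x = ∫ x in D, c * (F x i * φ x) := by
    refine integral_congr_ae ?_
    filter_upwards [Lp.coeFn_smul c F] with x hx
    rw [hx]; simp [mul_assoc]
  rw [h1, h2, integral_const_mul, integral_const_mul, hf φ hφ i]
  ring

theorem isDiffQuot_zero (t : ℝ) : IsDiffQuot D t 0 0 := by
  have h := Lp.coeFn_zero ℝ 2 (vol D)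
  unfold IsDiffQuot
  filter_upwards [Lp.coeFn_zero ℝ 2 ((vol D).prod (vol D)),
    Measure.quasiMeasurePreserving_fst.ae h, Measure.quasiMeasurePreserving_snd.ae h]
    with z h0 h1 h2
  rw [h0, h1, h2]; simp

theorem IsDiffQuot.add {t : ℝ} {f g : L2 D} {F G : L2Prod D} (hf : IsDiffQuot D t f F)
    (hg : IsDiffQuot D t g G) : IsDiffQuot D t (f + g) (F + G) := by
  have h := Lp.coeFn_add f g
  unfold IsDiffQuot at *
  filter_upwards [Lp.coeFn_add F G, Measure.quasiMeasurePreserving_fst.ae h,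
    Measure.quasiMeasurePreserving_snd.ae h, hf, hg] with z h0 h1 h2 h3 h4
  rw [h0, h1, h2, Pi.add_apply, Pi.add_apply, Pi.add_apply, h3, h4]
  ring

theorem IsDiffQuot.smul {t : ℝ} (c : ℝ) {f : L2 D} {F : L2Prod D} (hf : IsDiffQuot D t f F) :
    IsDiffQuot D t (c • f) (c • F) := by
  have h := Lp.coeFn_smul c f
  unfold IsDiffQuot at *
  filter_upwards [Lp.coeFn_smul c F, Measure.quasiMeasurePreserving_fst.ae h,
    Measure.quasiMeasurePreserving_snd.ae h, hf] with z h0 h1 h2 h3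
  rw [h0, h1, h2, Pi.smul_apply, Pi.smul_apply, Pi.smul_apply, h3]
  simp only [smul_eq_mul]
  ring

end helpers

/-! ### `H(div, D)` and Sobolev spaces

Each space is realised as the (closed) subspace of a product of `L²`-spaces formed by the functions
together with their derivatives; it carries the norm of that Hilbert space. -/

/-- `H(div, D)`: pairs `(v, div v) ∈ L²(D)^d × L²(D)`, with
`‖v‖²_{H(div)} = ‖v‖² + ‖div v‖²`. -/
def Hdiv {d : ℕ} (D : Set (E d)) : Submodule ℝ (WithLp 2 (L2Vec D × L2 D)) where
  carrier := {z | IsWeakDiv D z.fst z.snd}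
  zero_mem' := isWeakDiv_zero
  add_mem' := fun hz hw => IsWeakDiv.add hz hw
  smul_mem' := fun c _ hz => IsWeakDiv.smul c hz

/-- `H¹(D)`: pairs `(f, ∇f) ∈ L²(D) × L²(D)^d`. -/
def H1 {d : ℕ} (D : Set (E d)) : Submodule ℝ (WithLp 2 (L2 D × L2Vec D)) where
  carrier := {z | IsWeakGrad D z.fst z.snd}
  zero_mem' := isWeakGrad_zero
  add_mem' := fun hz hw => IsWeakGrad.add hz hw
  smul_mem' := fun c _ hz => IsWeakGrad.smul c hz

/-- `H^t(D)` for `0 < t ≤ 1`. For `t = 1` its elements are the triples `(f, ∇f, 0)`, so that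
`‖f‖²_{H¹} = ‖f‖² + ‖∇f‖²`. For `t < 1` they are the triples `(f, 0, F)` with `F` the weighted
difference quotient of `f`, so that `‖f‖²_{H^t} = ‖f‖² + ∫∫ |f(x) - f(y)|² / |x - y|^{d + 2t}`. -/
def Hsob {d : ℕ} (D : Set (E d)) (t : ℝ) :
    Submodule ℝ (WithLp 2 (L2 D × WithLp 2 (L2Vec D × L2Prod D))) where
  carrier := {z |
    (t = 1 → IsWeakGrad D z.fst z.snd.fst ∧ z.snd.snd = 0) ∧
    (t ≠ 1 → z.snd.fst = 0 ∧ IsDiffQuot D t z.fst z.snd.snd)}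
  zero_mem' := ⟨fun _ => ⟨isWeakGrad_zero, rfl⟩, fun _ => ⟨rfl, isDiffQuot_zero t⟩⟩
  add_mem' := fun {z w} hz hw =>
    ⟨fun h => ⟨(hz.1 h).1.add (hw.1 h).1, by
        simp [(hz.1 h).2, (hw.1 h).2]⟩,
      fun h => ⟨by simp [(hz.2 h).1, (hw.2 h).1],
        (hz.2 h).2.add (hw.2 h).2⟩⟩
  smul_mem' := fun c z hz =>
    ⟨fun h => ⟨(hz.1 h).1.smul c, by simp [(hz.1 h).2]⟩,
      fun h => ⟨by simp [(hz.2 h).1], (hz.2 h).2.smul c⟩⟩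

/-- The vector field underlying an element of `H(div, D)`. -/
def Hdiv.field {d : ℕ} {D : Set (E d)} (v : Hdiv D) : L2Vec D := v.1.fst

/-- The divergence of an element of `H(div, D)`. -/
def Hdiv.div {d : ℕ} {D : Set (E d)} (v : Hdiv D) : L2 D := v.1.snd

/-- The function underlying an element of `H¹(D)`. -/
def H1.fn {d : ℕ} {D : Set (E d)} (Φ : H1 D) : L2 D := Φ.1.fst

/-- The weak gradient of an element of `H¹(D)`. -/
def H1.grad {d : ℕ} {D : Set (E d)} (Φ : H1 D) : L2Vec D := Φ.1.snd

/-- The function underlying an element of `H^t(D)`. -/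
def Hsob.fn {d : ℕ} {D : Set (E d)} {t : ℝ} (f : Hsob D t) : L2 D := f.1.fst

/-! ### Traces -/

/-- The surface measure of `∂D`, up to the constant normalising factor of the `(d-1)`-dimensional
Hausdorff measure, which plays no role for the space `L²(∂D)` and its convergence. -/
def surf {d : ℕ} (D : Set (E d)) : Measure (E d) :=
  (Measure.hausdorffMeasure ((d : ℝ) - 1)).restrict (frontier D)

/-- `w ∈ L²(∂D)` is the trace of `Φ ∈ H¹(D)`: there are `φₙ ∈ C^∞` up to the boundary
with `φₙ → Φ` in `H¹(D)` and `φₙ|_{∂D} → w` in `L²(∂D)`. -/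
def HasTrace {d : ℕ} (D : Set (E d)) (Φ : H1 D) (w : Lp ℝ 2 (surf D)) : Prop :=
  ∃ φ : ℕ → E d → ℝ, (∀ n, ContDiff ℝ (⊤ : ℕ∞) (φ n)) ∧
    Tendsto (fun n => eLpNorm (fun x => φ n x - H1.fn Φ x) 2 (vol D)) atTop (𝓝 0) ∧
    Tendsto (fun n => eLpNorm (fun x => gradient (φ n) x - H1.grad Φ x) 2 (vol D)) atTop (𝓝 0) ∧
    Tendsto (fun n => eLpNorm (fun x => φ n x - w x) 2 (surf D)) atTop (𝓝 0)

/-- `w ∈ H^{1/2 + t}(∂D)`, the space of traces of functions `Φ ∈ H^{1 + t}(D)`, that is,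
`Φ ∈ H¹(D)` with `∂ᵢΦ ∈ H^t(D)` for all `i` (`0 < t ≤ 1`). -/
def MemTraceSpace {d : ℕ} (D : Set (E d)) (t : ℝ) (w : Lp ℝ 2 (surf D)) : Prop :=
  ∃ Φ : H1 D, HasTrace D Φ w ∧
    ∀ i : Fin d, ∃ z : Hsob D t, ∀ᵐ x ∂(vol D), Hsob.fn z x = H1.grad Φ x i

open scoped Classical in
/-- The boundary term `∫_{∂D} w v · ν ds` for `v ∈ H(div, D)` and `w ∈ H^{1/2}(∂D)`, that is, the
duality pairing of `w` with the normal trace `v · ν ∈ H^{-1/2}(∂D)`. As usual it is given by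
Green's formula `∫_D (v · ∇Φ + Φ div v) dx`, where `Φ ∈ H¹(D)` is any function with trace `w`; the
value does not depend on `Φ`, because a function with zero trace is a limit in `H¹(D)` of test
functions. -/
def normalPairing {d : ℕ} (D : Set (E d)) (w : Lp ℝ 2 (surf D)) (v : Hdiv D) : ℝ :=
  if h : ∃ Φ : H1 D, HasTrace D Φ w then
    ∫ x in D, (inner ℝ (Hdiv.field v x) (H1.grad h.choose x) + H1.fn h.choose x * Hdiv.div v x)
  else 0

/-! ### The coefficient -/

/-- The norm of `C^t(closure D)`: `sup |a| + sup |a(x) - a(y)| / |x - y|^t` over `closure D`. It is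
infinite exactly if the restriction of `a` to `closure D` is not in `C^t`. -/
def holderENorm {d : ℕ} (D : Set (E d)) (t : ℝ≥0) (a : E d → ℝ) : ℝ≥0∞ :=
  (⨆ x ∈ closure D, ‖a x‖ₑ) + eHolderNorm t (fun x : closure D => a x)

/-- `a_min = min_{closure D} a`. -/
def aMin {d : ℕ} (D : Set (E d)) (a : E d → ℝ) : ℝ := sInf (a '' closure D)

/-! ### The mixed problem for a fixed realisation -/

/-- `m(η, v) = (a⁻¹ η, v)_{L²(D)}`. -/
def formM {d : ℕ} (D : Set (E d)) (a : E d → ℝ) (η v : Hdiv D) : ℝ :=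
  ∫ x in D, (a x)⁻¹ * inner ℝ (Hdiv.field η x) (Hdiv.field v x)

/-- `b(v, w) = -(div v, w)_{L²(D)}`. -/
def formB {d : ℕ} (D : Set (E d)) (v : Hdiv D) (w : L2 D) : ℝ :=
  -∫ x in D, Hdiv.div v x * w x

/-- `G(v) = (g, v)_{L²(D)} - ∫_{∂D} u_Γ v · ν ds`. -/
def functionalG {d : ℕ} (D : Set (E d)) (g : Fin d → L2 D) (uΓ : Lp ℝ 2 (surf D))
    (v : Hdiv D) : ℝ :=
  (∫ x in D, ∑ i, g i x * Hdiv.field v x i) - normalPairing D uΓ v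

/-- `F(w) = -(f, w)_{L²(D)}`. -/
def functionalF {d : ℕ} (D : Set (E d)) (f : L2 D) (w : L2 D) : ℝ :=
  -∫ x in D, f x * w x

/-- `(q, u) ∈ H(div, D) × L²(D)` solves the mixed problem with data `a`, `g`, `f`, `u_Γ`. -/
structure IsMixedSolution {d : ℕ} (D : Set (E d)) (a : E d → ℝ) (g : Fin d → L2 D) (f : L2 D)
    (uΓ : Lp ℝ 2 (surf D)) (q : Hdiv D) (u : L2 D) : Prop where
  darcy : ∀ v : Hdiv D, formM D a q v + formB D v u = functionalG D g uΓ v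
  mass : ∀ w : L2 D, formB D q w = functionalF D f w

end MixedDarcy

end

noncomputable section

namespace MixedDarcy

/-! ### The weak divergence in terms of test gradients -/

/-! The Poincaré inequality bounds a test function by its gradient, so `φ` depends continuously on
`∇φ`; minus the adjoint of that dependence is a bounded right inverse `R` of the weak divergence
(`exists_isWeakDiv_right_inverse`). This replaces the inf-sup condition. Since `div q = f`, one
writes `q = R f + k` with `k` solenoidal, and testing the flux equation with solenoidal fields
leaves an equation for `k` alone, in which `u` has disappeared.

Scaled by `m = a_min`, that equation is governed by multiplication by `m / a`, which differs from
the identity by at most `1 - m / M`, where `M` is the Hölder norm of `a`. A contraction on the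
solenoidal fields therefore yields `k`, with `m / M * ‖k‖ ≤ ‖y‖` for the load `y`
(`exists_tendsto_iterate_relax`). The pressure is recovered with the adjoint of `R`, and uniqueness
follows from coercivity and `R`.

Being a limit of explicit iterates, `k` is measurable once multiplication by the random coefficient
preserves measurability (`aestronglyMeasurable_mulL`). The norms of `q` and `u` are controlled by
products of `M`, `1 / m` and the data norms. Hölder's inequality then gives every moment below `r`,
because `M` and `1 / m` have all finite moments (`memLp_mul_of_forall_lt`). -/

/-- A bound `‖f x‖ ≤ C ‖e x‖` makes `f` factor through `e`; the negative adjoint of the factor. -/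
theorem exists_inner_eq_neg_inner {T H L : Type*} [AddCommGroup T] [Module ℝ T]
    [NormedAddCommGroup H] [InnerProductSpace ℝ H] [CompleteSpace H]
    [NormedAddCommGroup L] [InnerProductSpace ℝ L] [CompleteSpace L]
    (e : T →ₗ[ℝ] H) (f : T →ₗ[ℝ] L) (C : ℝ) (h : ∀ x, ‖f x‖ ≤ C * ‖e x‖) :
    ∃ R : L →L[ℝ] H, ∀ w x, inner ℝ (e x) (R w) = -inner ℝ (f x) w := by
  -- On the closure of the range, `e` becomes dense, so the bound extends `e x ↦ f x` continuously;
  -- off this closure nothing is prescribed.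
  let N : Submodule ℝ H := (LinearMap.range e).topologicalClosure
  have hN : IsClosed (N : Set H) := Submodule.isClosed_topologicalClosure _
  have : CompleteSpace N := hN.completeSpace_coe
  let e' : T →ₗ[ℝ] N := e.codRestrict N fun x =>
    Submodule.le_topologicalClosure _ (LinearMap.mem_range_self e x)
  have hd : DenseRange e' := by
    intro y
    rw [Topology.IsInducing.subtypeVal.closure_eq_preimage_closure_image]
    have hy : (y : H) ∈ closure (LinearMap.range e : Set H) := y.2
    refine closure_mono ?_ hy
    rintro _ ⟨x, rfl⟩
    exact ⟨e' x, ⟨x, rfl⟩, rfl⟩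
  let F : N →L[ℝ] L := f.extendOfNorm e'
  have hF : ∀ x, F (e' x) = f x := LinearMap.extendOfNorm_eq hd ⟨C, h⟩
  refine ⟨-(N.subtypeL ∘L ContinuousLinearMap.adjoint F), fun w x => ?_⟩
  have h1 : inner ℝ (e x) (N.subtypeL (ContinuousLinearMap.adjoint F w))
      = inner ℝ (e' x) (ContinuousLinearMap.adjoint F w) := rfl
  rw [neg_apply, ContinuousLinearMap.comp_apply, inner_neg_right, h1,
    ContinuousLinearMap.adjoint_inner_right, hF]

section weakDiv

variable {d : ℕ} {D : Set (E d)}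

/-- The space `C_c^∞(D)`. -/
def testSpace (D : Set (E d)) : Submodule ℝ (E d → ℝ) where
  carrier := {φ | IsTestFunction D φ}
  zero_mem' := ⟨contDiff_const, HasCompactSupport.zero, by simp [tsupport]⟩
  add_mem' := fun {φ ψ} hφ hψ => ⟨hφ.smooth.add hψ.smooth, hφ.compact.add hψ.compact,
    (tsupport_add φ ψ).trans (Set.union_subset hφ.support hψ.support)⟩
  smul_mem' := fun c φ hφ => ⟨contDiff_const.smul hφ.smooth, hφ.compact.smul_left,
    (tsupport_smul_subset_right (fun _ => c) φ).trans hφ.support⟩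

theorem IsTestFunction.memLp_gradient {φ : E d → ℝ} (hφ : IsTestFunction D φ) :
    MemLp (gradient φ) 2 (vol D) :=
  ((InnerProductSpace.toDual ℝ (E d)).symm.toContinuousLinearEquiv.toContinuousLinearMap
    : (E d →L[ℝ] ℝ) →L[ℝ] E d).comp_memLp' hφ.memLp_fderiv

/-- The embedding of `C_c^∞(D)` into `L²(D)`. -/
def testToL2 (D : Set (E d)) : testSpace D →ₗ[ℝ] L2 D where
  toFun φ := φ.2.memLp.toLp φ.1
  map_add' φ ψ := MemLp.toLp_add φ.2.memLp ψ.2.memLp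
  map_smul' c φ := MemLp.toLp_const_smul c φ.2.memLp

/-- The gradient from `C_c^∞(D)` to `L²(D)^d`. -/
def testGrad (D : Set (E d)) : testSpace D →ₗ[ℝ] L2Vec D where
  toFun φ := φ.2.memLp_gradient.toLp (gradient φ.1)
  map_add' φ ψ := by
    rw [← MemLp.toLp_add φ.2.memLp_gradient ψ.2.memLp_gradient]
    congr 1
    funext x
    simp only [gradient, Submodule.coe_add, Pi.add_apply]
    rw [fderiv_add (φ.2.smooth.differentiable (by simp) x) (ψ.2.smooth.differentiable (by simp) x),
      map_add]
  map_smul' c φ := by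
    rw [RingHom.id_apply, ← MemLp.toLp_const_smul c φ.2.memLp_gradient]
    congr 1
    funext x
    simp only [gradient, Submodule.coe_smul, Pi.smul_apply]
    rw [fderiv_const_smul (φ.2.smooth.differentiable (by simp) x), map_smul]

theorem coeFn_testToL2 (φ : testSpace D) : testToL2 D φ =ᵐ[vol D] φ.1 :=
  MemLp.coeFn_toLp φ.2.memLp

theorem coeFn_testGrad (φ : testSpace D) : testGrad D φ =ᵐ[vol D] gradient φ.1 :=
  MemLp.coeFn_toLp φ.2.memLp_gradient

/-- In this form the weak divergence is minus the adjoint of the test gradient, so inverting it on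
the right amounts to bounding that gradient from below. -/
theorem isWeakDiv_iff_inner (v : L2Vec D) (ρ : L2 D) :
    IsWeakDiv D v ρ ↔
      ∀ φ : testSpace D, inner ℝ (testGrad D φ) v = -inner ℝ (testToL2 D φ) ρ := by
  have h1 (φ : testSpace D) :
      inner ℝ (testGrad D φ) v = ∫ x in D, fderiv ℝ φ.1 x (v x) := by
    rw [L2.inner_def]
    refine integral_congr_ae ?_
    filter_upwards [coeFn_testGrad φ] with x hx
    rw [hx, inner_gradient_left]
  have h2 (φ : testSpace D) :
      inner ℝ (testToL2 D φ) ρ = ∫ x in D, ρ x * φ.1 x := by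
    rw [L2.inner_def]
    refine integral_congr_ae ?_
    filter_upwards [coeFn_testToL2 φ] with x hx
    rw [hx]
    simp
  simp only [h1, h2]
  exact ⟨fun h φ => h φ.1 φ.2, fun h φ hφ => h ⟨φ, hφ⟩⟩

/-- The **Poincaré inequality** for test functions on a bounded domain. -/
theorem norm_testToL2_le (i : Fin d) {B : ℝ} (hD : MeasurableSet D)
    (hB : ∀ x ∈ D, ‖x‖ ≤ B) (φ : testSpace D) :
    ‖testToL2 D φ‖ ≤ 2 * B * ‖testGrad D φ‖ := by
  obtain ⟨φ, hφ⟩ := φ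
  set φ' : testSpace D := ⟨φ, hφ⟩ with hφ'
  let e : E d := EuclideanSpace.single i (1 : ℝ)
  have hdiff : Differentiable ℝ φ := hφ.smooth.differentiable (by simp)
  have hcd : Continuous fun x => fderiv ℝ φ x e :=
    (hφ.smooth.continuous_fderiv (by simp)).clm_apply continuous_const
  have hcx : Continuous fun x : E d => x i := by fun_prop
  have hxd (x : E d) : HasFDerivAt (fun x : E d => x i) (EuclideanSpace.proj (𝕜 := ℝ) i) x :=
    (EuclideanSpace.proj (𝕜 := ℝ) i).hasFDerivAt
  have hsq (x : E d) : fderiv ℝ (fun x => φ x * φ x) x e = 2 * (φ x * fderiv ℝ φ x e) := by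
    rw [fderiv_fun_mul (hdiff x) (hdiff x)]
    simp
    ring
  -- Integrating `x i` against `∂ᵢ(φ²)` by parts gives `∫ φ² = -2 ∫ φ xᵢ ∂ᵢφ`. The 2 in the constant
  -- comes from the product rule, and `B` bounds `|xᵢ|` on `D`.
  have key : ∫ x, x i * fderiv ℝ (fun x => φ x * φ x) x e
      = -∫ x, fderiv ℝ (fun x : E d => x i) x e * (φ x * φ x) := by
    refine integral_mul_fderiv_eq_neg_fderiv_mul_of_integrable ?_ ?_ ?_
      (fun x _ => (hxd x).differentiableAt) (fun x _ => (hdiff x).mul (hdiff x))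
    · simp only [(hxd _).fderiv]
      refine Continuous.integrable_of_hasCompactSupport ?_ ?_
      · exact continuous_const.mul (hdiff.continuous.mul hdiff.continuous)
      · exact (hφ.compact.mul_left (f := φ)).mul_left
    · simp only [hsq]
      refine Continuous.integrable_of_hasCompactSupport ?_ ?_
      · exact hcx.mul (continuous_const.mul (hdiff.continuous.mul hcd))
      · exact ((hφ.compact.mul_right).mul_left).mul_left
    · refine Continuous.integrable_of_hasCompactSupport ?_ ?_
      · exact hcx.mul (hdiff.continuous.mul hdiff.continuous)
      · exact (hφ.compact.mul_left (f := φ)).mul_left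
  have hzero : ∀ x, x ∉ D → φ x = 0 := fun x hx =>
    image_eq_zero_of_notMem_tsupport fun h => hx (hφ.support h)
  have h1 : ∫ x in D, φ x * φ x = -(2 * ∫ x in D, φ x * (x i * fderiv ℝ φ x e)) := by
    rw [setIntegral_eq_integral_of_forall_compl_eq_zero (fun x hx => by simp [hzero x hx]),
      setIntegral_eq_integral_of_forall_compl_eq_zero (fun x hx => by simp [hzero x hx]),
      ← integral_const_mul]
    have h2 (x : E d) : fderiv ℝ (fun x : E d => x i) x e * (φ x * φ x) = φ x * φ x := by
      rw [(hxd x).fderiv]; simp [e]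
    simp only [hsq, h2] at key
    rw [← neg_eq_iff_eq_neg, ← key]
    congr 1
    funext x
    ring
  have hmem : MemLp (fun x => x i * fderiv ℝ φ x e) 2 (vol D) := by
    refine ((hcx.mul hcd).memLp_of_hasCompactSupport ?_).restrict D
    exact (hφ.compact.fderiv_apply ℝ e).mul_left
  let ψ : L2 D := hmem.toLp _
  have hψ : ψ =ᵐ[vol D] fun x => x i * fderiv ℝ φ x e := hmem.coeFn_toLp
  have hψn : ‖ψ‖ ≤ B * ‖testGrad D φ'‖ := by
    refine Lp.norm_le_mul_norm_of_ae_le_mul ?_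
    filter_upwards [hψ, coeFn_testGrad φ', ae_restrict_mem hD] with x h1 h2 hx
    rw [h1, h2, norm_mul]
    refine mul_le_mul ((PiLp.norm_apply_le x i).trans (hB x hx)) ?_ (norm_nonneg _)
      ((norm_nonneg _).trans (hB x hx))
    rw [← inner_gradient_left]
    refine (norm_inner_le_norm _ _).trans ?_
    simp [e, hφ']
  have h3 : ‖testToL2 D φ'‖ ^ 2 = -(2 * inner ℝ (testToL2 D φ') ψ) := by
    rw [← real_inner_self_eq_norm_sq, L2.inner_def, L2.inner_def]
    refine Eq.trans ?_ (h1.trans ?_)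
    · refine integral_congr_ae ?_
      filter_upwards [coeFn_testToL2 φ'] with x hx
      rw [hx]; simp [hφ', sq]
    · congr 2
      refine integral_congr_ae ?_
      filter_upwards [coeFn_testToL2 φ', hψ] with x hx hx'
      rw [hx, hx']; simp [hφ']; ring
  have h4 : |inner ℝ (testToL2 D φ') ψ| ≤ ‖testToL2 D φ'‖ * ‖ψ‖ := abs_real_inner_le_norm _ _
  have h5 : ‖testToL2 D φ'‖ ^ 2 ≤ ‖testToL2 D φ'‖ * (2 * B * ‖testGrad D φ'‖) := by
    rw [h3]
    have := (abs_le.1 h4).1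
    nlinarith [norm_nonneg (testToL2 D φ'), mul_le_mul_of_nonneg_left hψn (norm_nonneg (testToL2 D φ'))]
  -- `B` is not known to be nonnegative, as `D` may be empty; in the degenerate case `‖ψ‖ ≥ 0`
  -- supplies the sign of the right-hand side.
  rcases (norm_nonneg (testToL2 D φ')).eq_or_lt with h0 | h0
  · rw [← h0]
    have := (norm_nonneg ψ).trans hψn
    linarith
  · rw [sq] at h5
    exact le_of_mul_le_mul_left h5 h0

/-- The divergence has a bounded right inverse `L²(D) → L²(D)^d`. -/
theorem exists_isWeakDiv_right_inverse (hd : 0 < d) (hD : MeasurableSet D)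
    (hb : Bornology.IsBounded D) :
    ∃ R : L2 D →L[ℝ] L2Vec D, ∀ w, IsWeakDiv D (R w) w := by
  obtain ⟨B, hB⟩ := hb.exists_norm_le
  obtain ⟨R, hR⟩ := exists_inner_eq_neg_inner (testGrad D) (testToL2 D) (2 * B)
    (norm_testToL2_le ⟨0, hd⟩ hD hB)
  exact ⟨R, fun w => (isWeakDiv_iff_inner _ _).2 (hR w)⟩

/-- The fields in `L²(D)^d` with vanishing weak divergence. -/
def solenoidal (D : Set (E d)) : Submodule ℝ (L2Vec D) := (LinearMap.range (testGrad D))ᗮ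

theorem mem_solenoidal {v : L2Vec D} : v ∈ solenoidal D ↔ IsWeakDiv D v 0 := by
  rw [isWeakDiv_iff_inner, solenoidal, Submodule.mem_orthogonal]
  simp only [LinearMap.mem_range, forall_exists_index, forall_apply_eq_imp_iff, inner_zero_right,
    neg_zero]

instance : CompleteSpace (solenoidal D) :=
  (Submodule.isClosed_orthogonal _).completeSpace_coe

end weakDiv

/-! ### Multiplication operators on `L²(D)^d` -/

section multiplication

variable {d : ℕ} {D : Set (E d)}

open scoped Classical in
/-- Multiplication by an essentially bounded function `c` (zero if `c` is not in `L^∞(D)`). -/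
def mulL (D : Set (E d)) (c : E d → ℝ) : L2Vec D →L[ℝ] L2Vec D :=
  if h : MemLp c ∞ (vol D) then
    (ContinuousLinearMap.lsmul ℝ ℝ).holderL (vol D) ∞ 2 2 (h.toLp c)
  else 0

theorem coeFn_mulL {c : E d → ℝ} (h : MemLp c ∞ (vol D)) (v : L2Vec D) :
    mulL D c v =ᵐ[vol D] fun x => c x • v x := by
  rw [mulL, dif_pos h]
  filter_upwards [ContinuousLinearMap.coeFn_holder (r := 2)
    (ContinuousLinearMap.lsmul ℝ ℝ : ℝ →L[ℝ] E d →L[ℝ] E d) (h.toLp c) v, h.coeFn_toLp]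
    with x hx hx'
  refine hx.trans ?_
  rw [hx']
  rfl

theorem inner_mulL {c : E d → ℝ} (h : MemLp c ∞ (vol D)) (v w : L2Vec D) :
    inner ℝ (mulL D c v) w = ∫ x in D, c x * inner ℝ (v x) (w x) := by
  rw [L2.inner_def]
  refine integral_congr_ae ?_
  filter_upwards [coeFn_mulL h v] with x hx
  rw [hx, real_inner_smul_left]

theorem norm_mulL_le {c : E d → ℝ} (h : MemLp c ∞ (vol D)) {C : ℝ}
    (hC : ∀ᵐ x ∂(vol D), |c x| ≤ C) (v : L2Vec D) : ‖mulL D c v‖ ≤ C * ‖v‖ := by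
  refine Lp.norm_le_mul_norm_of_ae_le_mul ?_
  filter_upwards [coeFn_mulL h v, hC] with x hx hx'
  rw [hx, norm_smul]
  exact mul_le_mul_of_nonneg_right hx' (norm_nonneg _)

theorem norm_sub_mulL_le {c : E d → ℝ} (h : MemLp c ∞ (vol D)) {C : ℝ}
    (hC : ∀ᵐ x ∂(vol D), |1 - c x| ≤ C) (v : L2Vec D) : ‖v - mulL D c v‖ ≤ C * ‖v‖ := by
  refine Lp.norm_le_mul_norm_of_ae_le_mul ?_
  filter_upwards [coeFn_mulL h v, hC, Lp.coeFn_sub v (mulL D c v)] with x hx hx' hx''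
  have h1 : v x - c x • v x = (1 - c x) • v x := by rw [sub_smul, one_smul]
  rw [hx'', Pi.sub_apply, hx, h1, norm_smul]
  exact mul_le_mul_of_nonneg_right hx' (norm_nonneg _)

/-- Strong convergence needs only bounded pointwise convergence of the multipliers: the squared
error is dominated by `(2C)² ‖v‖²`. -/
theorem tendsto_mulL {c : ℕ → E d → ℝ} {c₀ : E d → ℝ} {C : ℝ}
    (hm : ∀ n, AEStronglyMeasurable (c n) (vol D)) (hm₀ : AEStronglyMeasurable c₀ (vol D))
    (hC : ∀ n, ∀ᵐ x ∂(vol D), ‖c n x‖ ≤ C) (hC₀ : ∀ᵐ x ∂(vol D), ‖c₀ x‖ ≤ C)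
    (hlim : ∀ᵐ x ∂(vol D), Tendsto (fun n => c n x) atTop (𝓝 (c₀ x))) (v : L2Vec D) :
    Tendsto (fun n => mulL D (c n) v) atTop (𝓝 (mulL D c₀ v)) := by
  have hL (n : ℕ) : MemLp (c n) ∞ (vol D) := memLp_top_of_bound (hm n) C (hC n)
  have hL₀ : MemLp c₀ ∞ (vol D) := memLp_top_of_bound hm₀ C hC₀
  rw [tendsto_iff_norm_sub_tendsto_zero]
  have hsq : Tendsto (fun n => ‖mulL D (c n) v - mulL D c₀ v‖ ^ 2) atTop (𝓝 0) := by
    have h1 (n : ℕ) : ‖mulL D (c n) v - mulL D c₀ v‖ ^ 2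
        = ∫ x in D, (c n x - c₀ x) ^ 2 * ‖v x‖ ^ 2 := by
      rw [← real_inner_self_eq_norm_sq, L2.inner_def]
      refine integral_congr_ae ?_
      filter_upwards [coeFn_mulL (hL n) v, coeFn_mulL hL₀ v,
        Lp.coeFn_sub (mulL D (c n) v) (mulL D c₀ v)] with x h1 h2 h3
      rw [h3, Pi.sub_apply, h1, h2, ← sub_smul, real_inner_self_eq_norm_sq, norm_smul, mul_pow,
        Real.norm_eq_abs, sq_abs]
    simp only [h1]
    have hv : Integrable (fun x => ‖v x‖ ^ 2) (vol D) := (Lp.memLp v).integrable_norm_pow (by simp)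
    have h0 : (0 : ℝ) = ∫ x in D, (0 : ℝ) := by simp
    rw [h0]
    refine tendsto_integral_of_dominated_convergence (fun x => (2 * C) ^ 2 * ‖v x‖ ^ 2)
      (fun n => (((hm n).sub hm₀).pow 2).mul hv.1) (hv.const_mul _) (fun n => ?_) ?_
    · filter_upwards [hC n, hC₀] with x h1 h2
      rw [Real.norm_eq_abs, abs_mul, abs_of_nonneg (sq_nonneg ‖v x‖), abs_of_nonneg (sq_nonneg _)]
      refine mul_le_mul_of_nonneg_right (sq_le_sq' ?_ ?_) (sq_nonneg _)
      · linarith [(abs_le.1 h1).1, (abs_le.1 h2).2]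
      · linarith [(abs_le.1 h1).2, (abs_le.1 h2).1]
    · filter_upwards [hlim] with x hx
      have h2 := ((hx.sub_const (c₀ x)).pow 2).mul_const (‖v x‖ ^ 2)
      simpa using h2
  have h2 := (Real.continuous_sqrt.tendsto 0).comp hsq
  rw [Real.sqrt_zero] at h2
  refine h2.congr fun n => ?_
  simp [Real.sqrt_sq]

theorem memLp_top_indicator_one {s : Set (E d)} (hs : MeasurableSet s) :
    MemLp (s.indicator fun _ => (1 : ℝ)) ∞ (vol D) :=
  (memLp_top_const (1 : ℝ)).indicator hs

/-- This separates randomness from space: for random `b` the operators on the right are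
deterministic, and only finitely many point values of `b` enter. -/
theorem mulL_comp_simpleFunc (π : SimpleFunc (E d) (E d)) (b : E d → ℝ) (v : L2Vec D) :
    mulL D (fun x => b (π x)) v
      = ∑ y ∈ π.range, b y • mulL D ((π ⁻¹' {y}).indicator fun _ => (1 : ℝ)) v := by
  have hb : MemLp (fun x => b (π x)) ∞ (vol D) := (π.map b).memLp_top _
  have hi (y : E d) := memLp_top_indicator_one (D := D) (π.measurableSet_preimage {y})
  refine Lp.ext ?_
  have hall : ∀ᵐ x ∂(vol D), ∀ y ∈ π.range,
      (b y • mulL D ((π ⁻¹' {y}).indicator fun _ => (1 : ℝ)) v : L2Vec D) x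
        = b y • ((π ⁻¹' {y}).indicator (fun _ => (1 : ℝ)) x • v x) := by
    refine (Finset.eventually_all _).2 fun y _ => ?_
    filter_upwards [coeFn_mulL (hi y) v,
      Lp.coeFn_smul (b y) (mulL D ((π ⁻¹' {y}).indicator fun _ => (1 : ℝ)) v)] with x h1 h2
    rw [h2, Pi.smul_apply, h1]
  filter_upwards [coeFn_mulL hb v, hall, Lp.coeFn_finsetSum π.range fun y =>
    b y • mulL D ((π ⁻¹' {y}).indicator fun _ => (1 : ℝ)) v] with x h1 h2 h3
  rw [h1, h3, Finset.sum_apply, Finset.sum_congr rfl h2,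
    Finset.sum_eq_single_of_mem (π x) (π.mem_range_self x)]
  · simp
  · intro y _ hy
    rw [Set.indicator_of_notMem (by simpa using hy.symm)]
    simp

/-- Sampling the coefficient along a simple approximation of the identity gives measurable finite
sums; continuity of each realisation lets them converge. Measurability in operator norm is not
needed. -/
theorem aestronglyMeasurable_mulL {Ω : Type*} [MeasurableSpace Ω] {P : Measure Ω}
    (hD : MeasurableSet D) (hne : D.Nonempty) {c : Ω → E d → ℝ} {C : ℝ}
    (hc : ∀ x ∈ D, AEMeasurable (fun ω => c ω x) P)
    (hcont : ∀ᵐ ω ∂P, ContinuousOn (c ω) D) (hbd : ∀ᵐ ω ∂P, ∀ x ∈ D, |c ω x| ≤ C)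
    {v : Ω → L2Vec D} (hv : AEStronglyMeasurable v P) :
    AEStronglyMeasurable (fun ω => mulL D (c ω) (v ω)) P := by
  obtain ⟨y₀, h₀⟩ := hne
  -- The approximations take values in `D` everywhere, so the coefficient is sampled only where
  -- measurability and the bound are available.
  let π : ℕ → SimpleFunc (E d) (E d) := SimpleFunc.approxOn id measurable_id D y₀ h₀
  have hπ (n : ℕ) (x : E d) : π n x ∈ D := SimpleFunc.approxOn_mem measurable_id h₀ n x
  refine aestronglyMeasurable_of_tendsto_ae atTop
    (f := fun n ω => mulL D (fun x => c ω (π n x)) (v ω)) (fun n => ?_) ?_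
  · simp only [mulL_comp_simpleFunc]
    refine Finset.aestronglyMeasurable_fun_sum _ fun y hy => ?_
    obtain ⟨x, rfl⟩ := SimpleFunc.mem_range.1 hy
    exact (hc _ (hπ n x)).aestronglyMeasurable.smul
      ((ContinuousLinearMap.continuous _).comp_aestronglyMeasurable hv)
  · filter_upwards [hcont, hbd] with ω h1 h2
    refine tendsto_mulL (C := C)
      (fun n => ((π n).map (c ω)).measurable.aestronglyMeasurable)
      (h1.aestronglyMeasurable hD) (fun n => ?_) ?_ ?_ (v ω)
    · exact Eventually.of_forall fun x => h2 _ (hπ n x)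
    · filter_upwards [ae_restrict_mem hD] with x hx using h2 x hx
    · filter_upwards [ae_restrict_mem hD] with x hx
      have h3 : Tendsto (fun n => π n x) atTop (𝓝 x) :=
        SimpleFunc.tendsto_approxOn measurable_id h₀ (subset_closure hx)
      exact (h1 x hx).tendsto.comp
        (tendsto_nhdsWithin_iff.2 ⟨h3, Eventually.of_forall fun n => hπ n x⟩)

end multiplication

/-! ### Projected linear equations -/

section projection

variable {H : Type*} [NormedAddCommGroup H] [InnerProductSpace ℝ H]

/-- One step `k ↦ Π_K (k - T k + y)` of the relaxation for the equation `Π_K T k = Π_K y`. -/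
def relax (K : Submodule ℝ H) [K.HasOrthogonalProjection] (T : H →L[ℝ] H) (y : H) (k : K) : K :=
  K.orthogonalProjectionOnto (k - T k + y)

theorem coercive_of_norm_sub_le {T : H →L[ℝ] H} {θ : ℝ}
    (hT : ∀ v, ‖v - T v‖ ≤ (1 - θ) * ‖v‖) (v : H) : θ * ‖v‖ ^ 2 ≤ inner ℝ (T v) v := by
  have h1 : inner ℝ (v - T v) v ≤ (1 - θ) * ‖v‖ * ‖v‖ :=
    (real_inner_le_norm _ _).trans (mul_le_mul_of_nonneg_right (hT v) (norm_nonneg _))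
  rw [inner_sub_left, real_inner_self_eq_norm_sq] at h1
  nlinarith

/-- The projection is nonexpansive, so `relax` contracts with factor `1 - θ`. Banach's theorem is
preferred to an abstract existence result because the convergent iterates also carry measurability.
-/
theorem exists_tendsto_iterate_relax [CompleteSpace H] (K : Submodule ℝ H) [CompleteSpace K]
    (T : H →L[ℝ] H) (y : H) {θ : ℝ} (hθ : 0 < θ) (hθ1 : θ ≤ 1)
    (hT : ∀ v, ‖v - T v‖ ≤ (1 - θ) * ‖v‖) :
    ∃ k : K, Tendsto (fun n => (relax K T y)^[n] 0) atTop (𝓝 k) ∧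
      (∀ v ∈ K, inner ℝ (T k) v = inner ℝ y v) ∧ θ * ‖k‖ ≤ ‖y‖ := by
  have hc : ContractingWith (1 - θ).toNNReal (relax K T y) := by
    refine ⟨?_, LipschitzWith.of_dist_le_mul fun k l => ?_⟩
    · rw [← NNReal.coe_lt_coe, Real.coe_toNNReal _ (by linarith), NNReal.coe_one]
      linarith
    · rw [Real.coe_toNNReal _ (by linarith), dist_eq_norm, dist_eq_norm, relax, relax, ← map_sub]
      refine (K.norm_orthogonalProjectionOnto_apply_le _).trans ?_
      have h1 : (k : H) - T k + y - (l - T l + y) = (k - l : K) - T (k - l : K) := by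
        rw [Submodule.coe_sub, map_sub]
        abel
      rw [h1]
      exact hT _
  set k := ContractingWith.fixedPoint _ hc with hk
  have hfix : relax K T y k = k := hc.fixedPoint_isFixedPt
  have heq : ∀ v ∈ K, inner ℝ (T k) v = inner ℝ y v := by
    intro v hv
    have h1 : inner ℝ ((relax K T y k : K) : H) v = inner ℝ ((k : H) - T k + y) v := by
      have := Submodule.inner_orthogonalProjectionOnto_eq_of_mem_right ⟨v, hv⟩ ((k : H) - T k + y)
      exact this
    rw [hfix, inner_add_left, inner_sub_left] at h1
    linarith
  refine ⟨k, hc.tendsto_iterate_fixedPoint 0, heq, ?_⟩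
  have h1 := coercive_of_norm_sub_le hT (k : H)
  rw [heq k k.2] at h1
  have h2 : θ * ‖k‖ * ‖k‖ ≤ ‖y‖ * ‖k‖ := by
    have h3 := real_inner_le_norm y (k : H)
    rw [Submodule.coe_norm] at *
    nlinarith
  rcases (norm_nonneg k).eq_or_lt with h0 | h0
  · rw [← h0]; simp
  · exact le_of_mul_le_mul_right h2 h0

end projection

/-! ### The mixed problem for a fixed realisation -/

section deterministic

variable {d : ℕ} {D : Set (E d)}

/-- A bounded map into `H(div, D)` from a bounded field and a bounded divergence. -/
def hdivLift {X : Type*} [NormedAddCommGroup X] [NormedSpace ℝ X] (S : X →L[ℝ] L2Vec D)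
    (T : X →L[ℝ] L2 D) (h : ∀ x, IsWeakDiv D (S x) (T x)) : X →L[ℝ] Hdiv D :=
  (((WithLp.prodContinuousLinearEquiv 2 ℝ (L2Vec D) (L2 D)).symm.toContinuousLinearMap).comp
    (S.prod T)).codRestrict (Hdiv D) h

/-- The field of an element of `H(div, D)`, as a bounded operator. -/
def fieldL (D : Set (E d)) : Hdiv D →L[ℝ] L2Vec D :=
  (ContinuousLinearMap.fst ℝ (L2Vec D) (L2 D)).comp
    ((WithLp.prodContinuousLinearEquiv 2 ℝ (L2Vec D) (L2 D)).toContinuousLinearMap.comp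
      (Hdiv D).subtypeL)

theorem norm_field_le (v : Hdiv D) : ‖Hdiv.field v‖ ≤ ‖v‖ :=
  WithLp.norm_fst_le _ v.1

theorem Hdiv.ext {v w : Hdiv D} (h1 : Hdiv.field v = Hdiv.field w)
    (h2 : Hdiv.div v = Hdiv.div w) : v = w :=
  Subtype.ext (WithLp.ofLp_injective 2 (Prod.ext h1 h2))

/-- The function underlying an element of `H^t(D)`, as a bounded operator. -/
def fnL (D : Set (E d)) (t : ℝ) : Hsob D t →L[ℝ] L2 D :=
  (ContinuousLinearMap.fst ℝ (L2 D) (WithLp 2 (L2Vec D × L2Prod D))).comp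
    ((WithLp.prodContinuousLinearEquiv 2 ℝ (L2 D)
      (WithLp 2 (L2Vec D × L2Prod D))).toContinuousLinearMap.comp (Hsob D t).subtypeL)

/-- The vector field with given components in `L²(D)`. -/
def vecField (g : Fin d → L2 D) : L2Vec D :=
  ∑ i, (ContinuousLinearMap.toSpanSingleton ℝ (EuclideanSpace.single i (1 : ℝ))).compLpL 2
    (vol D) (g i)

theorem inner_vecField (g : Fin d → L2 D) (v : L2Vec D) :
    inner ℝ (vecField g) v = ∫ x in D, ∑ i, g i x * v x i := by
  have h (i : Fin d) : Integrable (fun x => g i x * v x i) (vol D) :=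
    (Lp.memLp _).integrable_mul ((EuclideanSpace.proj (𝕜 := ℝ) i).comp_memLp' (Lp.memLp v))
  rw [integral_finsetSum _ fun i _ => h i, vecField, sum_inner]
  refine Finset.sum_congr rfl fun i _ => ?_
  rw [L2.inner_def]
  refine integral_congr_ae ?_
  filter_upwards [ContinuousLinearMap.coeFn_compLp
    (ContinuousLinearMap.toSpanSingleton ℝ (EuclideanSpace.single i (1 : ℝ))) (g i)] with x hx
  refine (congrArg (fun z => inner ℝ z (v x)) hx).trans ?_
  rw [ContinuousLinearMap.toSpanSingleton_apply, real_inner_smul_left]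
  simp [EuclideanSpace.inner_single_left]

/-- The definition chooses the extension from `w` alone, so one `Φ` serves every `v` and
independence of the choice is not needed. -/
theorem exists_normalPairing_eq {w : Lp ℝ 2 (surf D)} (h : ∃ Φ : H1 D, HasTrace D Φ w) :
    ∃ Φ : H1 D, HasTrace D Φ w ∧ ∀ v : Hdiv D, normalPairing D w v
      = inner ℝ (H1.grad Φ) (Hdiv.field v) + inner ℝ (H1.fn Φ) (Hdiv.div v) := by
  refine ⟨h.choose, h.choose_spec, fun v => ?_⟩
  rw [normalPairing, dif_pos h, integral_add, real_inner_comm, L2.inner_def, L2.inner_def]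
  · congr 1
    refine integral_congr_ae (Eventually.of_forall fun x => ?_)
    simp [mul_comm]
  · exact L2.integrable_inner (𝕜 := ℝ) (Hdiv.field v) (H1.grad h.choose)
  · exact (Lp.memLp _).integrable_mul (Lp.memLp _)

/-- The normalised inverse coefficient `x ↦ m / a(x)`, for `m` a lower bound of `a`. -/
def invCoeff (m : ℝ) (a : E d → ℝ) (x : E d) : ℝ := m / a x

/-- `a` is continuous on `D` with `0 < m ≤ a ≤ M`. -/
structure IsCoeff (D : Set (E d)) (a : E d → ℝ) (m M : ℝ) : Prop where
  continuousOn : ContinuousOn a D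
  pos : 0 < m
  le : m ≤ M
  lower : ∀ x ∈ D, m ≤ a x
  upper : ∀ x ∈ D, a x ≤ M

namespace IsCoeff

variable {a : E d → ℝ} {m M : ℝ}

theorem pos_upper (h : IsCoeff D a m M) : 0 < M := h.pos.trans_le h.le

theorem pos_apply (h : IsCoeff D a m M) {x : E d} (hx : x ∈ D) : 0 < a x :=
  h.pos.trans_le (h.lower x hx)

theorem continuousOn_invCoeff (h : IsCoeff D a m M) : ContinuousOn (invCoeff m a) D :=
  continuousOn_const.div h.continuousOn fun _ hx => (h.pos_apply hx).ne'

theorem invCoeff_le (h : IsCoeff D a m M) {x : E d} (hx : x ∈ D) : |invCoeff m a x| ≤ 1 := by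
  rw [invCoeff, abs_of_nonneg (div_nonneg h.pos.le (h.pos_apply hx).le)]
  exact (div_le_one (h.pos_apply hx)).2 (h.lower x hx)

/-- The normalisation puts `m / a` in `[m / M, 1]`, which fixes the contraction factor. -/
theorem one_sub_invCoeff_le (h : IsCoeff D a m M) {x : E d} (hx : x ∈ D) :
    |1 - invCoeff m a x| ≤ 1 - m / M := by
  have h1 := (abs_le.1 (h.invCoeff_le hx)).2
  have h2 : m / M ≤ invCoeff m a x :=
    div_le_div_of_nonneg_left h.pos.le (h.pos_apply hx) (h.upper x hx)
  rw [abs_of_nonneg (by linarith)]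
  linarith

theorem memLp_invCoeff (h : IsCoeff D a m M) (hD : MeasurableSet D) :
    MemLp (invCoeff m a) ∞ (vol D) := by
  refine memLp_top_of_bound (h.continuousOn_invCoeff.aestronglyMeasurable hD) 1 ?_
  filter_upwards [ae_restrict_mem hD] with x hx using h.invCoeff_le hx

theorem norm_mulL_le (h : IsCoeff D a m M) (hD : MeasurableSet D) (v : L2Vec D) :
    ‖mulL D (invCoeff m a) v‖ ≤ ‖v‖ := by
  refine (MixedDarcy.norm_mulL_le (h.memLp_invCoeff hD) (C := 1) ?_ v).trans (one_mul _).le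
  filter_upwards [ae_restrict_mem hD] with x hx using h.invCoeff_le hx

theorem norm_sub_mulL_le (h : IsCoeff D a m M) (hD : MeasurableSet D) (v : L2Vec D) :
    ‖v - mulL D (invCoeff m a) v‖ ≤ (1 - m / M) * ‖v‖ := by
  refine MixedDarcy.norm_sub_mulL_le (h.memLp_invCoeff hD) ?_ v
  filter_upwards [ae_restrict_mem hD] with x hx using h.one_sub_invCoeff_le hx

theorem formM_eq (h : IsCoeff D a m M) (hD : MeasurableSet D) (η v : Hdiv D) :
    formM D a η v = m⁻¹ * inner ℝ (mulL D (invCoeff m a) (Hdiv.field η)) (Hdiv.field v) := by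
  rw [inner_mulL (h.memLp_invCoeff hD), ← integral_const_mul, formM]
  congr 1
  funext x
  have hm := h.pos.ne'
  rw [invCoeff, div_eq_mul_inv, ← mul_assoc, ← mul_assoc, inv_mul_cancel₀ hm, one_mul]

end IsCoeff

theorem formB_eq (v : Hdiv D) (w : L2 D) : formB D v w = -inner ℝ (Hdiv.div v) w := by
  rw [formB, L2.inner_def]
  simp [mul_comm]

theorem functionalF_eq (f w : L2 D) : functionalF D f w = -inner ℝ f w := by
  rw [functionalF, L2.inner_def]
  simp [mul_comm]

variable {a : E d → ℝ} {m M : ℝ}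

/-- The mixed problem in operator form. -/
theorem isMixedSolution_iff (h : IsCoeff D a m M) (hD : MeasurableSet D)
    {uΓ : Lp ℝ 2 (surf D)} {Φ : H1 D}
    (hΦ : ∀ v : Hdiv D, normalPairing D uΓ v
      = inner ℝ (H1.grad Φ) (Hdiv.field v) + inner ℝ (H1.fn Φ) (Hdiv.div v))
    (g : Fin d → L2 D) (f : L2 D) (q : Hdiv D) (u : L2 D) :
    IsMixedSolution D a g f uΓ q u ↔
      (∀ v : Hdiv D,
        inner ℝ (m⁻¹ • mulL D (invCoeff m a) (Hdiv.field q) - (vecField g - H1.grad Φ))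
          (Hdiv.field v) = inner ℝ (u - H1.fn Φ) (Hdiv.div v)) ∧
      Hdiv.div q = f := by
  have h1 (v : Hdiv D) :
      formM D a q v + formB D v u = functionalG D g uΓ v ↔
        inner ℝ (m⁻¹ • mulL D (invCoeff m a) (Hdiv.field q) - (vecField g - H1.grad Φ))
          (Hdiv.field v) = inner ℝ (u - H1.fn Φ) (Hdiv.div v) := by
    rw [h.formM_eq hD, formB_eq, functionalG, ← inner_vecField, hΦ, inner_sub_left, inner_sub_left,
      inner_sub_left, real_inner_smul_left, real_inner_comm u]
    constructor <;> intro h <;> linarith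
  constructor
  · intro hs
    refine ⟨fun v => (h1 v).1 (hs.darcy v), ext_inner_right ℝ fun w => ?_⟩
    have := hs.mass w
    rw [formB_eq, functionalF_eq] at this
    exact neg_injective this
  · rintro ⟨hs, hq⟩
    refine ⟨fun v => (h1 v).2 (hs v), fun w => ?_⟩
    rw [formB_eq, functionalF_eq, hq]

variable {R : L2 D →L[ℝ] L2Vec D}

/-- The right inverse of the divergence, with values in `H(div, D)`. -/
def rightInvL (hR : ∀ w, IsWeakDiv D (R w) w) : L2 D →L[ℝ] Hdiv D :=
  hdivLift R (ContinuousLinearMap.id ℝ _) hR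

/-- The inclusion of the solenoidal fields into `H(div, D)`. -/
def solenoidalL (D : Set (E d)) : solenoidal D →L[ℝ] Hdiv D :=
  hdivLift (solenoidal D).subtypeL 0 fun v => mem_solenoidal.1 v.2

/-- Splitting `v` as this solenoidal part plus `R (div v)` reduces the flux equation to solenoidal
tests and a formula for the pressure. -/
theorem field_sub_right_inverse_mem (hR : ∀ w, IsWeakDiv D (R w) w) (v : Hdiv D) :
    Hdiv.field v - R (Hdiv.div v) ∈ solenoidal D := by
  rw [mem_solenoidal]
  have h := IsWeakDiv.add v.2 ((hR (Hdiv.div v)).smul (-1))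
  convert h using 1
  · rw [neg_one_smul, ← sub_eq_add_neg]; rfl
  · rw [neg_one_smul, ← sub_eq_add_neg]; exact (sub_self _).symm

/-- If `k` solves the projected equation, the mixed problem has the solution
`q = R f + k`, `u = Φ + R† (a⁻¹ q - G)`. -/
theorem isMixedSolution_of_projected (h : IsCoeff D a m M) (hD : MeasurableSet D)
    {uΓ : Lp ℝ 2 (surf D)} {Φ : H1 D}
    (hΦ : ∀ v : Hdiv D, normalPairing D uΓ v
      = inner ℝ (H1.grad Φ) (Hdiv.field v) + inner ℝ (H1.fn Φ) (Hdiv.div v))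
    (hR : ∀ w, IsWeakDiv D (R w) w)
    (g : Fin d → L2 D) (f : L2 D) (k : solenoidal D)
    (hk : ∀ v ∈ solenoidal D, inner ℝ (mulL D (invCoeff m a) k) v
      = inner ℝ (m • (vecField g - H1.grad Φ) - mulL D (invCoeff m a) (R f)) v)
    {q : Hdiv D} (hq : q = rightInvL hR f + solenoidalL D k) :
    IsMixedSolution D a g f uΓ q
      (H1.fn Φ + ContinuousLinearMap.adjoint R
        (m⁻¹ • mulL D (invCoeff m a) (Hdiv.field q) - (vecField g - H1.grad Φ))) := by
  have hqf : Hdiv.field q = R f + k := by rw [hq]; rfl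
  have hqd : Hdiv.div q = f := by rw [hq]; exact add_zero _
  rw [isMixedSolution_iff h hD hΦ]
  refine ⟨fun v => ?_, hqd⟩
  -- With the adjoint moved across, the residual must vanish on `v - R (div v)`, which is
  -- solenoidal, so `hk` applies.
  rw [add_sub_cancel_left, ContinuousLinearMap.adjoint_inner_left, ← sub_eq_zero,
    ← inner_sub_right]
  have h1 := hk _ (field_sub_right_inverse_mem hR v)
  rw [inner_sub_left, real_inner_smul_left] at h1
  rw [inner_sub_left, real_inner_smul_left, hqf, map_add, inner_add_left, h1]
  have hm := h.pos.ne'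
  field_simp
  ring

/-- Uniqueness for the mixed problem. -/
theorem IsMixedSolution.unique (h : IsCoeff D a m M) (hD : MeasurableSet D)
    (hR : ∀ w, IsWeakDiv D (R w) w) {uΓ : Lp ℝ 2 (surf D)} {Φ : H1 D}
    (hΦ : ∀ v : Hdiv D, normalPairing D uΓ v
      = inner ℝ (H1.grad Φ) (Hdiv.field v) + inner ℝ (H1.fn Φ) (Hdiv.div v))
    (g : Fin d → L2 D) (f : L2 D) {q q' : Hdiv D} {u u' : L2 D}
    (h1 : IsMixedSolution D a g f uΓ q u)
    (h2 : IsMixedSolution D a g f uΓ q' u') :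
    q' = q ∧ u' = u := by
  rw [isMixedSolution_iff h hD hΦ] at h1 h2
  have hdiff (v : Hdiv D) :
      m⁻¹ * inner ℝ (mulL D (invCoeff m a) (Hdiv.field q' - Hdiv.field q)) (Hdiv.field v)
        = inner ℝ (u' - u) (Hdiv.div v) := by
    have e1 := h1.1 v
    have e2 := h2.1 v
    simp only [inner_sub_left, real_inner_smul_left, map_sub] at e1 e2 ⊢
    linarith
  have hdz : Hdiv.div (q' - q) = 0 := by
    have : Hdiv.div (q' - q) = Hdiv.div q' - Hdiv.div q := rfl
    rw [this, h1.2, h2.2, sub_self]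
  have hfs : Hdiv.field (q' - q) = Hdiv.field q' - Hdiv.field q := rfl
  have hz : Hdiv.field q' - Hdiv.field q = 0 := by
    -- The flux difference is divergence free, so testing with it removes the pressure and
    -- coercivity forces it to vanish.
    have e := hdiff (q' - q)
    rw [hdz, inner_zero_right, hfs] at e
    have e' := (mul_eq_zero.1 e).resolve_left (inv_ne_zero h.pos.ne')
    have c := coercive_of_norm_sub_le (h.norm_sub_mulL_le hD) (Hdiv.field q' - Hdiv.field q)
    rw [e'] at c
    have hθ : 0 < m / M := div_pos h.pos h.pos_upper
    have : ‖Hdiv.field q' - Hdiv.field q‖ ^ 2 ≤ 0 := nonpos_of_mul_nonpos_right c hθ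
    exact norm_eq_zero.1 (pow_eq_zero_iff two_ne_zero |>.1 (le_antisymm this (sq_nonneg _)))
  refine ⟨Hdiv.ext (sub_eq_zero.1 hz) (h2.2.trans h1.2.symm), sub_eq_zero.1 ?_⟩
  -- This test field has divergence `u' - u`, so the identity says `‖u' - u‖² = 0`.
  have e := hdiff (rightInvL hR (u' - u))
  rw [hz, map_zero, inner_zero_left, mul_zero] at e
  exact inner_self_eq_zero.1 (e.symm)

end deterministic

/-! ### Moments and the random coefficient -/

section moments

variable {Ω : Type*} [MeasurableSpace Ω] {P : Measure Ω}

/-- Take `1/s = 1/p - 1/r`: it is at most 1 because `p ≥ 1`, and positive because `p < r` is strict.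
-/
theorem exists_holderTriple_of_lt {p r : ℝ≥0∞} (hp : 1 ≤ p) (hpr : p < r) :
    ∃ s : ℝ≥0∞, 1 ≤ s ∧ s ≠ ⊤ ∧ ENNReal.HolderTriple s r p := by
  refine ⟨(p⁻¹ - r⁻¹)⁻¹, ?_, ?_, ⟨?_⟩⟩
  · exact ENNReal.one_le_inv.2 (tsub_le_self.trans (ENNReal.inv_le_one.2 hp))
  · exact ENNReal.inv_ne_top.2 (tsub_pos_of_lt (ENNReal.inv_lt_inv.2 hpr)).ne'
  · rw [inv_inv]
    exact tsub_add_cancel_of_le (ENNReal.inv_le_inv.2 hpr.le)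

/-- Multiplication by a random variable with all moments preserves moments of order `< r`. -/
theorem memLp_mul_of_forall_lt {Z X : Ω → ℝ} {r : ℝ≥0∞}
    (hZ : ∀ p : ℝ≥0∞, 1 ≤ p → p ≠ ⊤ → MemLp Z p P)
    (hX : ∀ p : ℝ≥0∞, 1 ≤ p → p < r → MemLp X p P) {p : ℝ≥0∞} (hp : 1 ≤ p) (hpr : p < r) :
    MemLp (fun ω => Z ω * X ω) p P := by
  -- `X` has moments only strictly below `r`, so Hölder is applied at an intermediate exponent. The
  -- conclusion then has the same shape as `hX`, and the lemma can be iterated.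
  obtain ⟨p', h1, h2⟩ := exists_between hpr
  obtain ⟨s, hs1, hs2, hs⟩ := exists_holderTriple_of_lt hp h1
  exact (hX p' (hp.trans h1.le) h2).mul (hZ s hs1 hs2)

variable {d : ℕ} {D : Set (E d)} {s : ℝ≥0}

theorem isCoeff_of_holderENorm_ne_top (hne : D.Nonempty) (hs : 0 < s) {a : E d → ℝ}
    (ha : 0 < aMin D a) (hfin : holderENorm D s a ≠ ⊤) :
    IsCoeff D a (aMin D a) (holderENorm D s a).toReal := by
  have hsup : (⨆ x ∈ closure D, ‖a x‖ₑ) ≤ holderENorm D s a := le_self_add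
  have hH : eHolderNorm s (fun x : closure D => a x) ≠ ⊤ :=
    ne_top_of_le_ne_top hfin le_add_self
  have hup : ∀ x ∈ closure D, |a x| ≤ (holderENorm D s a).toReal := by
    intro x hx
    have h1 : ‖a x‖ₑ ≤ holderENorm D s a := (le_iSup₂ (f := fun x _ => ‖a x‖ₑ) x hx).trans hsup
    have h2 := ENNReal.toReal_mono hfin h1
    rwa [toReal_enorm, Real.norm_eq_abs] at h2
  have hlow : ∀ x ∈ D, aMin D a ≤ a x := by
    intro x hx
    -- Without a lower bound on the values, `sInf` would be a default value; the finite sup norm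
    -- provides one.
    refine csInf_le ⟨-(holderENorm D s a).toReal, ?_⟩ ⟨x, subset_closure hx, rfl⟩
    rintro _ ⟨y, hy, rfl⟩
    exact (abs_le.1 (hup y hy)).1
  have hupD : ∀ x ∈ D, a x ≤ (holderENorm D s a).toReal := fun x hx =>
    (abs_le.1 (hup x (subset_closure hx))).2
  obtain ⟨C, hC⟩ := eHolderNorm_ne_top.1 hH
  obtain ⟨x₀, hx₀⟩ := hne
  refine ⟨?_, ha, (hlow x₀ hx₀).trans (hupD x₀ hx₀), hlow, hupD⟩
  exact (continuousOn_iff_continuous_domRestrict.2 (hC.continuous hs)).mono subset_closure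

theorem memLp_toReal {X : Ω → ℝ≥0∞} {p : ℝ≥0∞} (hX : MemLp X p P) :
    MemLp (fun ω => (X ω).toReal) p P := by
  refine ⟨hX.1.aemeasurable.ennreal_toReal.aestronglyMeasurable,
    (eLpNorm_mono_enorm fun ω => ?_).trans_lt hX.2⟩
  rw [Real.enorm_of_nonneg ENNReal.toReal_nonneg]
  exact ENNReal.ofReal_toReal_le

theorem ae_ne_top_of_memLp_one {X : Ω → ℝ≥0∞} (hX : MemLp X 1 P) : ∀ᵐ ω ∂P, X ω ≠ ⊤ := by
  have h := hX.2
  rw [eLpNorm_one_eq_lintegral_enorm] at h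
  filter_upwards [ae_lt_top' hX.1.aemeasurable h.ne] with ω hω using hω.ne

theorem memLp_clm_apply {X Y : Type*} [NormedAddCommGroup X] [NormedSpace ℝ X]
    [NormedAddCommGroup Y] [NormedSpace ℝ Y] (L : X →L[ℝ] Y) {h : Ω → X} {p : ℝ≥0∞}
    (hh : MemLp h p P) : MemLp (fun ω => L (h ω)) p P :=
  L.comp_memLp' hh

theorem memLp_vecField {t : ℝ} {g : Ω → PiLp 2 (fun _ : Fin d => Hsob D t)} {p : ℝ≥0∞}
    (hg : MemLp g p P) : MemLp (fun ω => vecField fun i => Hsob.fn (g ω i)) p P := by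
  refine memLp_finsetSum _ fun i _ => memLp_clm_apply _ ?_
  have hi : MemLp (fun ω => g ω i) p P :=
    hg.of_le ((PiLp.continuous_apply 2 _ i).comp_aestronglyMeasurable hg.1)
      (Eventually.of_forall fun ω => PiLp.norm_apply_le (g ω) i)
  exact memLp_clm_apply (fnL D t) hi

/-- Each step applies `T ω` to a vector that is itself random, hence the form of `hT`. -/
theorem aestronglyMeasurable_iterate_relax {H : Type*} [NormedAddCommGroup H]
    [InnerProductSpace ℝ H] (K : Submodule ℝ H) [K.HasOrthogonalProjection]
    {T : Ω → H →L[ℝ] H} {y : Ω → H}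
    (hT : ∀ v : Ω → H, AEStronglyMeasurable v P → AEStronglyMeasurable (fun ω => T ω (v ω)) P)
    (hy : AEStronglyMeasurable y P) (n : ℕ) :
    AEStronglyMeasurable (fun ω => (relax K (T ω) (y ω))^[n] 0) P := by
  induction n with
  | zero => exact aestronglyMeasurable_const
  | succ n ih =>
    simp only [Function.iterate_succ_apply']
    have h1 : AEStronglyMeasurable (fun ω => (((relax K (T ω) (y ω))^[n] 0 : K) : H)) P :=
      continuous_subtype_val.comp_aestronglyMeasurable ih
    exact (ContinuousLinearMap.continuous _).comp_aestronglyMeasurable ((h1.sub (hT _ h1)).add hy)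

end moments

end MixedDarcy

end

/-! ### Assembly of the random solution: measurability, moments, uniqueness. -/

open MixedDarcy in
theorem mainTheorem12 {d : ℕ} (hd : d = 2 ∨ d = 3)
    (D : Set (E d)) (hD : IsLipschitzPolyhedralDomain D)
    {Ω : Type*} [MeasurableSpace Ω] (P : Measure Ω) [IsProbabilityMeasure P]
    -- the random coefficient
    (a : Ω → E d → ℝ) (ha : ∀ x ∈ closure D, AEMeasurable (fun ω => a ω x) P)
    -- A1
    (hA1 : ∀ᵐ ω ∂P, 0 < aMin D (a ω))
    (hA1' : ∀ p : ℝ≥0∞, 1 ≤ p → p ≠ ⊤ → MemLp (fun ω => 1 / aMin D (a ω)) p P)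
    -- A2
    (s : ℝ≥0) (hs : 0 < s) (hs1 : s ≤ 1)
    (hA2 : ∀ p : ℝ≥0∞, 1 ≤ p → p ≠ ⊤ → MemLp (fun ω => holderENorm D s (a ω)) p P)
    -- A3
    (t : ℝ) (ht : 0 < t) (ht1 : t ≤ 1) (r : ℝ≥0∞) (hr : 1 ≤ r) (hr' : r ≠ ⊤)
    (uΓ : Lp ℝ 2 (surf D)) (huΓ : MemTraceSpace D t uΓ)
    (g : Ω → PiLp 2 (fun _ : Fin d => Hsob D t)) (hg : MemLp g r P)
    (f : Ω → Hsob D t) (hf : MemLp f r P) :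
    ∃ (q : Ω → Hdiv D) (u : Ω → L2 D),
      -- `(q, u)` is a random solution
      AEStronglyMeasurable q P ∧ AEStronglyMeasurable u P ∧
      (∀ᵐ ω ∂P, IsMixedSolution D (a ω) (fun i => Hsob.fn (g ω i)) (Hsob.fn (f ω)) uΓ (q ω) (u ω)) ∧
      -- with the stated moments
      (∀ p : ℝ≥0∞, 1 ≤ p → p < r → MemLp q p P ∧ MemLp u p P) ∧
      -- and almost surely it is the only one
      (∀ᵐ ω ∂P, ∀ (q' : Hdiv D) (u' : L2 D),
        IsMixedSolution D (a ω) (fun i => Hsob.fn (g ω i)) (Hsob.fn (f ω)) uΓ q' u' →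
          q' = q ω ∧ u' = u ω) := by
  have hDm : MeasurableSet D := hD.isOpen.measurableSet
  have hne : D.Nonempty := hD.isConnected.nonempty
  obtain ⟨R, hR⟩ := exists_isWeakDiv_right_inverse (by omega) hDm hD.isBounded
  obtain ⟨Φ₀, hΦ₀, -⟩ := huΓ
  obtain ⟨Φ, -, hΦ⟩ := exists_normalPairing_eq ⟨Φ₀, hΦ₀⟩
  let m : Ω → ℝ := fun ω => aMin D (a ω)
  let M : Ω → ℝ := fun ω => (holderENorm D s (a ω)).toReal
  have hcoeff : ∀ᵐ ω ∂P, IsCoeff D (a ω) (m ω) (M ω) := by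
    filter_upwards [hA1, ae_ne_top_of_memLp_one (hA2 1 le_rfl ENNReal.one_ne_top)] with ω h1 h2
    exact isCoeff_of_holderENorm_ne_top hne hs h1 h2
  have hm : AEMeasurable m P := by
    -- Measurability of the minimum over uncountably many points is read off from that of its
    -- reciprocal.
    have h := (hA1' 1 le_rfl ENNReal.one_ne_top).1.aemeasurable.inv
    refine h.congr (Eventually.of_forall fun ω => ?_)
    simp [m]
  have hW : ∀ p : ℝ≥0∞, 1 ≤ p → p ≠ ⊤ → MemLp (fun ω => (m ω)⁻¹) p P := fun p h1 h2 => by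
    simpa only [one_div] using hA1' p h1 h2
  have hM : ∀ p : ℝ≥0∞, 1 ≤ p → p ≠ ⊤ → MemLp M p P := fun p h1 h2 => memLp_toReal (hA2 p h1 h2)
  -- the data
  let G : Ω → L2Vec D := fun ω => vecField (fun i => Hsob.fn (g ω i)) - H1.grad Φ
  let F : Ω → L2 D := fun ω => Hsob.fn (f ω)
  have hG : MemLp G r P := (memLp_vecField hg).sub (memLp_const _)
  have hF : MemLp F r P := memLp_clm_apply (fnL D t) hf
  let T : Ω → L2Vec D →L[ℝ] L2Vec D := fun ω => mulL D (invCoeff (m ω) (a ω))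
  have hT : ∀ v : Ω → L2Vec D, AEStronglyMeasurable v P →
      AEStronglyMeasurable (fun ω => T ω (v ω)) P := fun v hv =>
    aestronglyMeasurable_mulL (C := 1) hDm hne
      (fun x hx => hm.div (ha x (subset_closure hx)))
      (hcoeff.mono fun ω h => h.continuousOn_invCoeff)
      (hcoeff.mono fun ω h x hx => h.invCoeff_le hx) hv
  let y : Ω → L2Vec D := fun ω => m ω • G ω - T ω (R (F ω))
  have hy : AEStronglyMeasurable y P :=
    (hm.aestronglyMeasurable.smul hG.1).sub (hT _ (R.continuous.comp_aestronglyMeasurable hF.1))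
  -- the solenoidal part of the flux
  have hex : ∀ ω, ∃ k : solenoidal D, IsCoeff D (a ω) (m ω) (M ω) →
      Tendsto (fun n => (relax (solenoidal D) (T ω) (y ω))^[n] 0) atTop (𝓝 k) ∧
        (∀ v ∈ solenoidal D, inner ℝ (T ω k) v = inner ℝ (y ω) v) ∧
        m ω / M ω * ‖k‖ ≤ ‖y ω‖ := by
    intro ω
    by_cases h : IsCoeff D (a ω) (m ω) (M ω)
    · obtain ⟨k, hk⟩ := exists_tendsto_iterate_relax (solenoidal D) (T ω) (y ω)
        (div_pos h.pos h.pos_upper) ((div_le_one h.pos_upper).2 h.le) (h.norm_sub_mulL_le hDm)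
      exact ⟨k, fun _ => hk⟩
    -- An arbitrary value on a null set; measurability of `k` will come from the limit of the
    -- iterates, not from this choice.
    · exact ⟨0, fun h' => absurd h' h⟩
  choose k hk using hex
  have hkm : AEStronglyMeasurable k P :=
    aestronglyMeasurable_of_tendsto_ae atTop
      (aestronglyMeasurable_iterate_relax (solenoidal D) hT hy)
      (hcoeff.mono fun ω h => (hk ω h).1)
  let q : Ω → Hdiv D := fun ω => rightInvL hR (F ω) + solenoidalL D (k ω)
  have hq : AEStronglyMeasurable q P :=
    ((rightInvL hR).continuous.comp_aestronglyMeasurable hF.1).add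
      ((solenoidalL D).continuous.comp_aestronglyMeasurable hkm)
  let u : Ω → L2 D := fun ω => H1.fn Φ + ContinuousLinearMap.adjoint R
    ((m ω)⁻¹ • T ω (Hdiv.field (q ω)) - G ω)
  have hTq : AEStronglyMeasurable (fun ω => (m ω)⁻¹ • T ω (Hdiv.field (q ω))) P :=
    hm.inv.aestronglyMeasurable.smul
      (hT _ ((fieldL D).continuous.comp_aestronglyMeasurable hq))
  have hu : AEStronglyMeasurable u P :=
    aestronglyMeasurable_const.add
      ((ContinuousLinearMap.adjoint R).continuous.comp_aestronglyMeasurable (hTq.sub hG.1))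
  have hsol : ∀ᵐ ω ∂P, IsMixedSolution D (a ω) (fun i => Hsob.fn (g ω i)) (Hsob.fn (f ω)) uΓ
      (q ω) (u ω) := by
    filter_upwards [hcoeff] with ω h
    exact isMixedSolution_of_projected h hDm hΦ hR _ (F ω) (k ω) (hk ω h).2.1 rfl
  -- moments
  have hGp : ∀ p : ℝ≥0∞, 1 ≤ p → p < r → MemLp (fun ω => ‖G ω‖) p P := fun p _ h2 =>
    (hG.mono_exponent h2.le).norm
  have hFp : ∀ p : ℝ≥0∞, 1 ≤ p → p < r → MemLp (fun ω => ‖F ω‖) p P := fun p _ h2 =>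
    (hF.mono_exponent h2.le).norm
  have hkn : ∀ᵐ ω ∂P, ‖k ω‖ ≤ M ω * ‖G ω‖ + M ω * ((m ω)⁻¹ * ‖F ω‖) * ‖R‖ := by
    filter_upwards [hcoeff] with ω h
    have h1 := (hk ω h).2.2
    have h2 : ‖y ω‖ ≤ m ω * ‖G ω‖ + ‖R‖ * ‖F ω‖ := by
      refine (norm_sub_le _ _).trans (add_le_add ?_ ?_)
      · rw [norm_smul, Real.norm_of_nonneg h.pos.le]
      · exact (h.norm_mulL_le hDm _).trans (R.le_opNorm _)
    have hmp := h.pos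
    have hMp := h.pos_upper
    -- Multiplying the load by `M / m` cancels the `m` in front of `G`, leaving only `M` and `1 / m`
    -- as random factors.
    have h3 : ‖k ω‖ = M ω * (m ω)⁻¹ * (m ω / M ω * ‖k ω‖) := by field_simp
    calc ‖k ω‖ = M ω * (m ω)⁻¹ * (m ω / M ω * ‖k ω‖) := h3
      _ ≤ M ω * (m ω)⁻¹ * (m ω * ‖G ω‖ + ‖R‖ * ‖F ω‖) :=
          mul_le_mul_of_nonneg_left (h1.trans h2) (by positivity)
      _ = _ := by field_simp
  have hkp : ∀ p : ℝ≥0∞, 1 ≤ p → p < r → MemLp k p P := by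
    intro p h1 h2
    have h3 : MemLp (fun ω => M ω * ‖G ω‖ + M ω * ((m ω)⁻¹ * ‖F ω‖) * ‖R‖) p P := by
      refine (memLp_mul_of_forall_lt hM hGp h1 h2).add (MemLp.mul_const ?_ _)
      -- Two successive products, by `1 / m` and then by `M`, each lose an arbitrarily small amount
      -- of integrability.
      exact memLp_mul_of_forall_lt hM (fun p h1 h2 => memLp_mul_of_forall_lt hW hFp h1 h2) h1 h2
    exact h3.of_le hkm (hkn.mono fun ω h => h.trans (Real.le_norm_self _))
  have hqp : ∀ p : ℝ≥0∞, 1 ≤ p → p < r → MemLp q p P := fun p h1 h2 =>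
    (memLp_clm_apply (rightInvL hR) (hF.mono_exponent h2.le)).add
      (memLp_clm_apply (solenoidalL D) (hkp p h1 h2))
  have hup : ∀ p : ℝ≥0∞, 1 ≤ p → p < r → MemLp u p P := by
    intro p h1 h2
    have h3 : MemLp (fun ω => (m ω)⁻¹ • T ω (Hdiv.field (q ω))) p P := by
      refine (memLp_mul_of_forall_lt hW (fun p h1 h2 => (hqp p h1 h2).norm) h1 h2).of_le hTq ?_
      filter_upwards [hcoeff] with ω h
      rw [norm_smul, norm_mul, norm_norm]
      exact mul_le_mul_of_nonneg_left ((h.norm_mulL_le hDm _).trans (norm_field_le _))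
        (norm_nonneg _)
    exact (memLp_const (H1.fn Φ)).add (memLp_clm_apply (ContinuousLinearMap.adjoint R)
      (h3.sub (hG.mono_exponent h2.le)))
  refine ⟨q, u, hq, hu, hsol, fun p h1 h2 => ⟨hqp p h1 h2, hup p h1 h2⟩, ?_⟩
  filter_upwards [hcoeff, hsol] with ω h h1 q' u' h2
  exact h1.unique h hDm hR hΦ _ _ h2
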